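/- A finite simple graph $G$ is $2$-admissible if it has a spanning tree $T$ with $d_T(u,v)\le 2\,d_G(u,v)$ for all vertices $u,v$. It is $P_4$-tidy if for every induced path $P$ on four vertices of $G$ there is at most one vertex $v\in V(G)\setminus V(P)$ such that $V(P)\cup\{v\}$ induces at least two $P_4$'s in $G$. **Theorem.** $2$-admissibility can be decided in $O(n)$ time for $P_4$-tidy graphs with $n$ vertices. Precisely: there are a single program for a unit-cost random access machine (instructions: load a constant, add, truncated subtract, indirect load and store, jump, jump on comparison, halt with answer yes or no) and a constant $c$ such that, for every $n$ and every $P_4$-tidy graph $G$ with vertex set $\{0,\dots,n-1\}$, when the program is started on any adjacency-list representation of $G$, it halts after at most $c(n+1)$ steps, answers yes if and only if $G$ is $2$-admissible, and during the whole computation holds only numbers at most $(n+2)^c$ in its registers and memory cells (words of $O(\log n)$ bits). Here an adjacency-list representation of $G$ consists of the number $n$, a table of $n+1$ addresses, and then the lists of neighbours of the vertices $0,\dots,n-1$ one after the other, each list in arbitrary order; the list of $v$ occupies the addresses from the $v$-th table entry up to, but not including, the $(v+1)$-st (so that the degree of a vertex can be read in constant time). -/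

import Mathlib

/-! ### Tree spanners and admissibility -/

/-- `T` is a tree `t`-spanner of `G`: a spanning tree of `G` in which the distance between any two
vertices is at most `t` times their distance in `G`. -/
def SimpleGraph.IsTreeSpanner {V : Type*} (G T : SimpleGraph V) (t : ℕ) : Prop :=
  T ≤ G ∧ T.IsTree ∧ ∀ u v : V, T.dist u v ≤ t * G.dist u v

/-- `G` is `t`-admissible: it has a tree `t`-spanner. -/
def SimpleGraph.IsAdmissible {V : Type*} (G : SimpleGraph V) (t : ℕ) : Prop :=
  ∃ T : SimpleGraph V, G.IsTreeSpanner T t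

/-! ### `P₄`-tidy graphs -/

/-- The vertex set `W` induces a path on four vertices in `G`. -/
def SimpleGraph.InducesP4 {V : Type*} (G : SimpleGraph V) (W : Finset V) : Prop :=
  Nonempty (G.induce (W : Set V) ≃g SimpleGraph.pathGraph 4)

/-- The number of induced `P₄`'s of `G` all of whose vertices lie in `U`. -/
noncomputable def SimpleGraph.numP4 {V : Type*} (G : SimpleGraph V) (U : Finset V) : ℕ :=
  Set.ncard {W : Finset V | W ⊆ U ∧ G.InducesP4 W}

/-- `G` is `P₄`-tidy: for every induced `P₄` of `G`, with vertex set `P`, there is at most one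
vertex `v` outside `P` such that `P ∪ {v}` induces at least two `P₄`'s. -/
def SimpleGraph.IsP4Tidy {V : Type*} [DecidableEq V] (G : SimpleGraph V) : Prop :=
  ∀ P : Finset V, G.InducesP4 P → ∀ v w : V, v ∉ P → w ∉ P →
    2 ≤ G.numP4 (insert v P) → 2 ≤ G.numP4 (insert w P) → v = w

/-! ### Random access machines -/

namespace RAM

/-- Instructions of a random access machine with registers and an addressable memory, all of whose
cells hold natural numbers. Each instruction takes one unit of time. -/
inductive Instr : Type
  /-- `reg d := k` -/
  | const (d k : ℕ)
  /-- `reg d := reg a + reg b` -/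
  | add (d a b : ℕ)
  /-- `reg d := reg a - reg b`, truncated at `0` -/
  | sub (d a b : ℕ)
  /-- `reg d := mem (reg a)` -/
  | load (d a : ℕ)
  /-- `mem (reg a) := reg s` -/
  | store (a s : ℕ)
  /-- continue at instruction `l` -/
  | jump (l : ℕ)
  /-- continue at instruction `l` if `reg a < reg b`, and at the next instruction otherwise -/
  | jumpLT (a b l : ℕ)
  /-- stop with answer yes (`true`) or no (`false`) -/
  | halt (answer : Bool)

/-- A program is a finite list of instructions. -/
abbrev Program : Type := List Instr

/-- A configuration: program counter, registers and memory. -/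
structure Config : Type where
  pc : ℕ
  reg : ℕ → ℕ
  mem : ℕ → ℕ

/-- The effect of a single instruction. -/
def Instr.exec (i : Instr) (s : Config) : Config :=
  match i with
  | .const d k => ⟨s.pc + 1, Function.update s.reg d k, s.mem⟩
  | .add d a b => ⟨s.pc + 1, Function.update s.reg d (s.reg a + s.reg b), s.mem⟩
  | .sub d a b => ⟨s.pc + 1, Function.update s.reg d (s.reg a - s.reg b), s.mem⟩
  | .load d a => ⟨s.pc + 1, Function.update s.reg d (s.mem (s.reg a)), s.mem⟩
  | .store a k => ⟨s.pc + 1, s.reg, Function.update s.mem (s.reg a) (s.reg k)⟩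
  | .jump l => ⟨l, s.reg, s.mem⟩
  | .jumpLT a b l => ⟨if s.reg a < s.reg b then l else s.pc + 1, s.reg, s.mem⟩
  | .halt _ => s

/-- One step of the machine. If the program counter points outside the program, the machine is
stuck: it stays in the same configuration, without ever giving an answer. -/
def step (P : Program) (s : Config) : Config :=
  match P[s.pc]? with
  | some i => i.exec s
  | none => s

/-- The initial configuration: the input is written at the beginning of the memory, everything else
is `0`. -/
def init (input : List ℕ) : Config :=
  ⟨0, fun _ => 0, fun i => input.getD i 0⟩

/-- The configuration after `k` steps on the given input. -/
def run (P : Program) (input : List ℕ) (k : ℕ) : Config :=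
  (step P)^[k] (init input)

/-- On the given input, `P` has reached a halting instruction with answer `b` after at most `k`
steps. -/
def AnswersWithin (P : Program) (input : List ℕ) (k : ℕ) (b : Bool) : Prop :=
  ∃ j ≤ k, P[(run P input j).pc]? = some (Instr.halt b)

/-- Throughout the computation of `P` on the given input, all numbers in registers and in memory
are at most `B`. -/
def WordsBounded (P : Program) (input : List ℕ) (B : ℕ) : Prop :=
  ∀ k i : ℕ, (run P input k).reg i ≤ B ∧ (run P input k).mem i ≤ B

end RAM

/-! ### Adjacency lists -/

/-- `L` lists, for every vertex of `G`, its neighbours, each exactly once and in any order. -/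
def SimpleGraph.IsAdjList {n : ℕ} (G : SimpleGraph (Fin n)) (L : Fin n → List (Fin n)) : Prop :=
  ∀ v : Fin n, (L v).Nodup ∧ ∀ w : Fin n, w ∈ L v ↔ G.Adj v w

/-- The adjacency lists as a sequence of numbers: first `n`, then a table of `n + 1` addresses, then
the lists of the vertices `0, …, n - 1` one after the other. The list of the vertex `v` occupies the
addresses from `table v` up to, but not including, `table (v + 1)`. -/
def adjListInput {n : ℕ} (L : Fin n → List (Fin n)) : List ℕ :=
  [n] ++
    (List.range (n + 1)).map
      (fun k => n + 2 + ∑ v : Fin n, if (v : ℕ) < k then (L v).length else 0) ++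
    (List.ofFn fun v : Fin n => (L v).map fun w : Fin n => (w : ℕ)).flatten

/-! ### Induced paths on four vertices -/

/-! A `P₄`-tidy graph is 2-admissible exactly when it has a hub (`IsP4Tidy.isAdmissible_two_iff`).
From a hub `c` a spanner is built by joining the neighbours of `c` to `c` and every other vertex to
its only neighbour, which must itself be adjacent to `c` (`IsHub.isAdmissible`).

Conversely let `T` be a tree 2-spanner. Vertices at tree distance at least three are not adjacent in
`G`, so the only possible chords of a tree path join vertices two apart, and long tree paths yield
induced `P₄`'s. Tidiness enters only through `IsP4Tidy.eq_of_isEndPartner`: two distinct vertices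
cannot both see exactly one end of the same induced `P₄`. This excludes tree paths on seven vertices
and forces the chords of those on six to alternate, which makes one of the two middle vertices a
hub. If `T` has no path on six vertices, some `c` is within tree distance two of everything, and `c`
or one of its tree neighbours is a hub (`IsTreeSpanner.exists_isHub`).

A vertex is a hub iff its closed neighbourhood contains all non-pendant vertices, which is an
equality of two counts (`IsAdjList.isHub_iff`). A pendant vertex lies in only two closed
neighbourhoods, its own and that of its neighbour, so all counts are obtained in time O(n), whatever
the number of edges: degrees are differences of table entries, and a list is read only if it has
length one. -/

namespace SimpleGraph

variable {V : Type*}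

/-- The vertices `a, b, c, d` induce a path of `G`, in this order. -/
def IsP4 (G : SimpleGraph V) (a b c d : V) : Prop :=
  G.Adj a b ∧ G.Adj b c ∧ G.Adj c d ∧ ¬G.Adj a c ∧ ¬G.Adj a d ∧ ¬G.Adj b d

theorem IsP4.symm {G : SimpleGraph V} {a b c d : V} (h : G.IsP4 a b c d) : G.IsP4 d c b a := by
  obtain ⟨h1, h2, h3, h4, h5, h6⟩ := h
  exact ⟨h3.symm, h2.symm, h1.symm, fun h => h6 h.symm, fun h => h5 h.symm, fun h => h4 h.symm⟩

theorem IsP4.inducesP4 [DecidableEq V] {G : SimpleGraph V} {a b c d : V} (h : G.IsP4 a b c d) :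
    G.InducesP4 {a, b, c, d} := by
  obtain ⟨h1, h2, h3, h4, h5, h6⟩ := h
  have hac : a ≠ c := by rintro rfl; exact h5 h3
  have had : a ≠ d := by rintro rfl; exact h4 h3.symm
  have hbd : b ≠ d := by rintro rfl; exact h5 h1
  have hab := h1.ne
  have hbc := h2.ne
  have hcd := h3.ne
  have hadj : ∀ i j, G.Adj (![a, b, c, d] i) (![a, b, c, d] j) ↔ (pathGraph 4).Adj i j := by
    intro i j
    have h1' := h1.symm
    have h2' := h2.symm
    have h3' := h3.symm
    have h4' : ¬G.Adj c a := fun h => h4 h.symm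
    have h5' : ¬G.Adj d a := fun h => h5 h.symm
    have h6' : ¬G.Adj d b := fun h => h6 h.symm
    fin_cases i <;> fin_cases j <;> simp [pathGraph_adj, *]
  have hinj : Function.Injective ![a, b, c, d] := by
    intro i j hij
    fin_cases i <;> fin_cases j <;> simp_all
  let f : pathGraph 4 ↪g G := ⟨⟨![a, b, c, d], hinj⟩, hadj _ _⟩
  have hr : Set.range f = (({a, b, c, d} : Finset V) : Set V) := by
    change Set.range ![a, b, c, d] = _
    ext x
    simp [eq_comm]
    tauto
  unfold InducesP4
  rw [← hr]
  exact ⟨f.isoInduceRange.symm⟩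

theorem two_le_numP4 {G : SimpleGraph V} {U P Q : Finset V} (hP : P ⊆ U) (hQ : Q ⊆ U)
    (hGP : G.InducesP4 P) (hGQ : G.InducesP4 Q) (hPQ : P ≠ Q) : 2 ≤ G.numP4 U := by
  have hfin : {W : Finset V | W ⊆ U ∧ G.InducesP4 W}.Finite :=
    (U.powerset.finite_toSet).subset fun W hW => by simpa using hW.1
  exact (Set.one_lt_ncard hfin).2 ⟨P, ⟨hP, hGP⟩, Q, ⟨hQ, hGQ⟩, hPQ⟩

/-- A vertex outside an induced path adjacent to exactly one of the ends forms with the path a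
second induced `P₄`. -/
theorem IsP4.two_le_numP4_insert [DecidableEq V] {G : SimpleGraph V} {a b c d v : V}
    (h : G.IsP4 a b c d) (hv : v ∉ ({a, b, c, d} : Finset V)) (ha : G.Adj v a)
    (hd : ¬G.Adj v d) : 2 ≤ G.numP4 (insert v {a, b, c, d}) := by
  have key : ∀ Q : Finset V, Q ⊆ insert v {a, b, c, d} → v ∈ Q → G.InducesP4 Q →
      2 ≤ G.numP4 (insert v {a, b, c, d}) := fun Q hQ hvQ hGQ =>
    two_le_numP4 (Finset.subset_insert _ _) hQ h.inducesP4 hGQ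
      (by rintro rfl; exact hv hvQ)
  obtain ⟨h1, h2, h3, h4, h5, h6⟩ := h
  -- The second path is `a v c d`, `v b c d` or `v a b c`, according to the first of `c`, `b` that
  -- `v` sees.
  by_cases hc : G.Adj v c
  · refine key {a, v, c, d} ?_ (by simp) (IsP4.inducesP4 ⟨ha.symm, hc, h3, h4, h5, hd⟩)
    intro x; simp; tauto
  by_cases hb : G.Adj v b
  · refine key {v, b, c, d} ?_ (by simp) (IsP4.inducesP4 ⟨hb, h2, h3, hc, hd, h6⟩)
    intro x; simp; tauto
  · refine key {v, a, b, c} ?_ (by simp) (IsP4.inducesP4 ⟨ha, h1, h2, hb, hc, h4⟩)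
    intro x; simp; tauto

/-- `v` lies outside of `a, b, c, d` and is adjacent to exactly one of `a` and `d`. -/
def IsEndPartner (G : SimpleGraph V) (a b c d v : V) : Prop :=
  v ≠ a ∧ v ≠ b ∧ v ≠ c ∧ v ≠ d ∧ (G.Adj v a ↔ ¬G.Adj v d)

/-- The form in which tidiness is used: an end partner creates a second `P₄`, whichever end it sees,
by reversing the path. -/
theorem IsP4Tidy.eq_of_isEndPartner [DecidableEq V] {G : SimpleGraph V} (hG : G.IsP4Tidy)
    {a b c d v w : V} (h : G.IsP4 a b c d) (hv : G.IsEndPartner a b c d v)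
    (hw : G.IsEndPartner a b c d w) : v = w := by
  have key : ∀ u, G.IsEndPartner a b c d u →
      u ∉ ({a, b, c, d} : Finset V) ∧ 2 ≤ G.numP4 (insert u {a, b, c, d}) := by
    rintro u ⟨h1, h2, h3, h4, h5⟩
    have hu : u ∉ ({a, b, c, d} : Finset V) := by simp [h1, h2, h3, h4]
    refine ⟨hu, ?_⟩
    by_cases ha : G.Adj u a
    · exact h.two_le_numP4_insert hu ha (h5.1 ha)
    · have hset : ({a, b, c, d} : Finset V) = {d, c, b, a} := by ext x; simp; tauto
      rw [hset] at hu ⊢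
      exact h.symm.two_le_numP4_insert hu (by tauto) ha
  exact hG _ h.inducesP4 v w (key v hv).1 (key w hw).1 (key v hv).2 (key w hw).2

/-! ### Tree `2`-spanners -/

/-- `w` has exactly one neighbour, and this neighbour has a further neighbour. -/
def IsPendant (G : SimpleGraph V) (w : V) : Prop :=
  ∃ p, (∀ q, G.Adj w q ↔ q = p) ∧ ∃ q, q ≠ w ∧ G.Adj p q

/-- Every vertex outside the closed neighbourhood of `c` is pendant. -/
def IsHub (G : SimpleGraph V) (c : V) : Prop :=
  ∀ w, w ≠ c → ¬G.Adj c w → G.IsPendant w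

namespace IsTreeSpanner

variable {G T : SimpleGraph V}

theorem adj_or_exists (h : G.IsTreeSpanner T 2) {u v : V} (huv : G.Adj u v) :
    T.Adj u v ∨ ∃ m, T.Adj u m ∧ T.Adj m v := by
  obtain ⟨-, hT, hd⟩ := h
  obtain ⟨p, hp⟩ := hT.connected.exists_walk_length_eq_dist u v
  have h2 := hd u v
  rw [SimpleGraph.dist_eq_one_iff_adj.2 huv, ← hp] at h2
  match p, h2 with
  | .nil, _ => exact absurd rfl huv.ne
  | .cons h1 .nil, _ => exact .inl h1
  | .cons h1 (.cons h2 .nil), _ => exact .inr ⟨_, h1, h2⟩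
  | .cons h1 (.cons h2 (.cons h3 p)), h => simp at h

/-- Paths in a tree are unique, so the length of `p` is the tree distance, while adjacent vertices
have tree distance at most two. -/
theorem not_adj_of_isPath (h : G.IsTreeSpanner T 2) {u v : V} (p : T.Walk u v) (hp : p.IsPath)
    (hl : 3 ≤ p.length) : u ≠ v ∧ ¬G.Adj u v := by
  have hpath : p.length = T.dist u v := by
    obtain ⟨q, hq⟩ := h.2.1.connected.exists_walk_length_eq_dist u v
    have : (⟨p, hp⟩ : T.Path u v) = ⟨q, q.isPath_of_length_eq_dist hq⟩ :=
      (h.2.1.isAcyclic.subsingleton_path u v).elim _ _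
    rw [← hq]
    exact congrArg (fun r : T.Path u v => r.1.length) this
  constructor
  · rintro rfl
    rw [SimpleGraph.dist_self] at hpath
    omega
  · intro ha
    have := h.2.2 u v
    rw [SimpleGraph.dist_eq_one_iff_adj.2 ha, ← hpath] at this
    omega

theorem far_three (h : G.IsTreeSpanner T 2) {a b c d : V} (h1 : T.Adj a b) (h2 : T.Adj b c)
    (h3 : T.Adj c d) (hac : a ≠ c) (hbd : b ≠ d) : a ≠ d ∧ ¬G.Adj a d := by
  refine h.not_adj_of_isPath (.cons h1 (.cons h2 (.cons h3 .nil))) ?_ (by simp)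
  -- In a forest a walk without immediate backtracking is a path, so only vertices two apart need to
  -- be distinct.
  rw [h.2.1.isAcyclic.isPath_iff_isChain]
  simp [h1.ne, h2.ne, h3.ne, hac, hbd]

theorem far_four (h : G.IsTreeSpanner T 2) {a b c d e : V} (h1 : T.Adj a b) (h2 : T.Adj b c)
    (h3 : T.Adj c d) (h4 : T.Adj d e) (hac : a ≠ c) (hbd : b ≠ d) (hce : c ≠ e) :
    a ≠ e ∧ ¬G.Adj a e := by
  refine h.not_adj_of_isPath (.cons h1 (.cons h2 (.cons h3 (.cons h4 .nil)))) ?_ (by simp)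
  rw [h.2.1.isAcyclic.isPath_iff_isChain]
  simp [h1.ne, h2.ne, h3.ne, h4.ne, hac, hbd, hce]

theorem far_five (h : G.IsTreeSpanner T 2) {a b c d e f : V} (h1 : T.Adj a b) (h2 : T.Adj b c)
    (h3 : T.Adj c d) (h4 : T.Adj d e) (h5 : T.Adj e f) (hac : a ≠ c) (hbd : b ≠ d) (hce : c ≠ e)
    (hdf : d ≠ f) : a ≠ f ∧ ¬G.Adj a f := by
  refine h.not_adj_of_isPath (.cons h1 (.cons h2 (.cons h3 (.cons h4 (.cons h5 .nil))))) ?_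
    (by simp)
  rw [h.2.1.isAcyclic.isPath_iff_isChain]
  simp [h1.ne, h2.ne, h3.ne, h4.ne, h5.ne, hac, hbd, hce, hdf]

theorem far_six (h : G.IsTreeSpanner T 2) {a b c d e f g : V} (h1 : T.Adj a b) (h2 : T.Adj b c)
    (h3 : T.Adj c d) (h4 : T.Adj d e) (h5 : T.Adj e f) (h6 : T.Adj f g) (hac : a ≠ c)
    (hbd : b ≠ d) (hce : c ≠ e) (hdf : d ≠ f) (heg : e ≠ g) : a ≠ g ∧ ¬G.Adj a g := by
  refine h.not_adj_of_isPath
    (.cons h1 (.cons h2 (.cons h3 (.cons h4 (.cons h5 (.cons h6 .nil)))))) ?_ (by simp)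
  rw [h.2.1.isAcyclic.isPath_iff_isChain]
  simp [h1.ne, h2.ne, h3.ne, h4.ne, h5.ne, h6.ne, hac, hbd, hce, hdf, heg]

/-- In a `P₄`-tidy graph the chords of a path on six vertices of a tree `2`-spanner follow one of
two patterns. -/
theorem chords_of_six [DecidableEq V] (h : G.IsTreeSpanner T 2) (hG : G.IsP4Tidy)
    {a b c d e f : V} (h1 : T.Adj a b) (h2 : T.Adj b c) (h3 : T.Adj c d) (h4 : T.Adj d e)
    (h5 : T.Adj e f) (hac : a ≠ c) (hbd : b ≠ d) (hce : c ≠ e) (hdf : d ≠ f) :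
    (¬G.Adj a c ∧ G.Adj b d ∧ ¬G.Adj c e ∧ G.Adj d f) ∨
      (G.Adj a c ∧ ¬G.Adj b d ∧ G.Adj c e ∧ ¬G.Adj d f) := by
  obtain ⟨ad, nad⟩ := h.far_three h1 h2 h3 hac hbd
  obtain ⟨be, nbe⟩ := h.far_three h2 h3 h4 hbd hce
  obtain ⟨cf, ncf⟩ := h.far_three h3 h4 h5 hce hdf
  obtain ⟨ae, nae⟩ := h.far_four h1 h2 h3 h4 hac hbd hce
  obtain ⟨bf, nbf⟩ := h.far_four h2 h3 h4 h5 hbd hce hdf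
  obtain ⟨af, naf⟩ := h.far_five h1 h2 h3 h4 h5 hac hbd hce hdf
  have g1 := h.1 h1
  have g2 := h.1 h2
  have g3 := h.1 h3
  have g4 := h.1 h4
  have g5 := h.1 h5
  have e1 := hG.eq_of_isEndPartner (a := b) (b := c) (c := d) (d := e) (v := a) (w := f)
  have e2 := hG.eq_of_isEndPartner (a := b) (b := d) (c := e) (d := f) (v := a) (w := c)
  have e3 := hG.eq_of_isEndPartner (a := e) (b := c) (c := b) (d := a) (v := f) (w := d)
  have e4 := hG.eq_of_isEndPartner (a := a) (b := b) (c := d) (d := e) (v := c) (w := f)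
  have e5 := hG.eq_of_isEndPartner (a := f) (b := e) (c := c) (d := b) (v := d) (w := a)
  have e6 := hG.eq_of_isEndPartner (a := a) (b := b) (c := d) (d := f) (v := c) (w := e)
  simp only [IsP4, IsEndPartner] at e1 e2 e3 e4 e5 e6
  simp only [G.adj_comm] at *
  grind [g1.ne, g2.ne, g3.ne, g4.ne, g5.ne, SimpleGraph.adj_comm]

end IsTreeSpanner

end SimpleGraph

/-! ### From a tree 2-spanner to a hub -/

namespace SimpleGraph

variable {V : Type*}

namespace IsTreeSpanner

variable {G T : SimpleGraph V}

theorem not_path_seven [DecidableEq V] (h : G.IsTreeSpanner T 2) (hG : G.IsP4Tidy)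
    {a b c d e f g : V} (h1 : T.Adj a b) (h2 : T.Adj b c) (h3 : T.Adj c d) (h4 : T.Adj d e)
    (h5 : T.Adj e f) (h6 : T.Adj f g) (hac : a ≠ c) (hbd : b ≠ d) (hce : c ≠ e) (hdf : d ≠ f)
    (heg : e ≠ g) : False := by
  obtain ⟨ad, nad⟩ := h.far_three h1 h2 h3 hac hbd
  obtain ⟨be, nbe⟩ := h.far_three h2 h3 h4 hbd hce
  obtain ⟨cf, ncf⟩ := h.far_three h3 h4 h5 hce hdf
  obtain ⟨dg, ndg⟩ := h.far_three h4 h5 h6 hdf heg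
  obtain ⟨ae, nae⟩ := h.far_four h1 h2 h3 h4 hac hbd hce
  obtain ⟨bf, nbf⟩ := h.far_four h2 h3 h4 h5 hbd hce hdf
  obtain ⟨cg, ncg⟩ := h.far_four h3 h4 h5 h6 hce hdf heg
  obtain ⟨af, naf⟩ := h.far_five h1 h2 h3 h4 h5 hac hbd hce hdf
  obtain ⟨bg, nbg⟩ := h.far_five h2 h3 h4 h5 h6 hbd hce hdf heg
  obtain ⟨ag, nag⟩ := h.far_six h1 h2 h3 h4 h5 h6 hac hbd hce hdf heg
  have c1 := h.chords_of_six hG h1 h2 h3 h4 h5 hac hbd hce hdf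
  have c2 := h.chords_of_six hG h2 h3 h4 h5 h6 hbd hce hdf heg
  have g1 := h.1 h1
  have g2 := h.1 h2
  have g3 := h.1 h3
  have g4 := h.1 h4
  have g5 := h.1 h5
  have g6 := h.1 h6
  -- The chord patterns of the two six-vertex subpaths must agree, leaving either `bd, df` or `ac,
  -- ce, eg`. `e1` refutes the former, `e2` the latter.
  have e1 := hG.eq_of_isEndPartner (a := a) (b := b) (c := d) (d := f) (v := e) (w := g)
  have e2 := hG.eq_of_isEndPartner (a := a) (b := c) (c := e) (d := f) (v := b) (w := g)
  simp only [IsP4, IsEndPartner] at e1 e2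
  grind [g1.ne, g2.ne, g3.ne, g4.ne, g5.ne, g6.ne, SimpleGraph.adj_comm]

theorem path_cases (h : G.IsTreeSpanner T 2) (c g : V) :
    g = c ∨ T.Adj c g ∨ (∃ m, T.Adj c m ∧ T.Adj m g ∧ c ≠ g) ∨
      (∃ m k, T.Adj c m ∧ T.Adj m k ∧ T.Adj k g ∧ c ≠ k ∧ m ≠ g) ∨
      ∃ m k l r, T.Adj c m ∧ T.Adj m k ∧ T.Adj k l ∧ T.Adj l r ∧ c ≠ k ∧ m ≠ l ∧ k ≠ r := by
  obtain ⟨p, hp, -⟩ := h.2.1.existsUnique_path c g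
  rw [h.2.1.isAcyclic.isPath_iff_isChain] at hp
  match p, hp with
  | .nil, _ => exact .inl rfl
  | .cons h1 .nil, _ => exact .inr (.inl h1)
  | .cons h1 (.cons h2 .nil), hp =>
    refine .inr (.inr (.inl ⟨_, h1, h2, ?_⟩))
    rintro rfl
    simp [Sym2.eq_swap] at hp
  | .cons h1 (.cons h2 (.cons h3 .nil)), hp =>
    simp [h1.ne, h2.ne, h3.ne] at hp
    exact .inr (.inr (.inr (.inl ⟨_, _, h1, h2, h3, hp.1, hp.2⟩)))
  | .cons h1 (.cons h2 (.cons h3 (.cons h4 p))), hp =>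
    simp [h1.ne, h2.ne, h3.ne] at hp
    exact .inr (.inr (.inr (.inr ⟨_, _, _, _, h1, h2, h3, h4, hp.1, hp.2.1, hp.2.2.1⟩)))

/-- A vertex `g` at tree distance two or three from `d` on the side of `c` turns out to be pendant.
On any other side, distance two makes `dg` a chord by the alternating pattern, and distance three
gives a tree path on seven vertices. Distance four or more always gives such a path. -/
theorem isHub_of_six [DecidableEq V] (h : G.IsTreeSpanner T 2) (hG : G.IsP4Tidy)
    {a b c d e f : V} (h1 : T.Adj a b) (h2 : T.Adj b c) (h3 : T.Adj c d) (h4 : T.Adj d e)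
    (h5 : T.Adj e f) (hac : a ≠ c) (hbd : b ≠ d) (hce : c ≠ e) (hdf : d ≠ f)
    (gbd : G.Adj b d) (nce : ¬G.Adj c e) (gdf : G.Adj d f) : G.IsHub d := by
  obtain ⟨ncf', ncf⟩ := h.far_three h3 h4 h5 hce hdf
  have no7 : ∀ g k l, T.Adj g k → T.Adj k l → T.Adj l c → g ≠ l → k ≠ c → l ≠ d → False :=
    fun g k l t1 t2 t3 n1 n2 n3 => h.not_path_seven hG t1 t2 t3 h3 h4 h5 n1 n2 n3 hce hdf
  intro g hg hgn
  rcases h.path_cases d g with rfl | t1 | ⟨m, t1, t2, n1⟩ | ⟨m, k, t1, t2, t3, n1, n2⟩ |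
    ⟨m, k, l, r, t1, t2, t3, t4, n1, n2, n3⟩
  · exact absurd rfl hg
  · exact absurd (h.1 t1) hgn
  · by_cases hm : c = m
    · subst hm
      refine ⟨c, fun q => ⟨fun hq => ?_, ?_⟩, d, n1, h.1 h3⟩
      · by_contra hqc
        have no6 : ∀ r, T.Adj g r → r ≠ c → False := by
          intro r t hr
          have := h.chords_of_six hG t.symm t2.symm h3 h4 h5 hr hg hce hdf
          grind [SimpleGraph.adj_comm]
        rcases h.adj_or_exists hq with t | ⟨r, t, t'⟩
        · exact no6 q t hqc
        · by_cases hr : r = c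
          · subst hr
            have nqd : q ≠ d := by rintro rfl; exact hgn hq.symm
            obtain ⟨nge', nge⟩ := h.far_three t2.symm h3 h4 hg hce
            obtain ⟨nqe', nqe⟩ := h.far_three t'.symm h3 h4 nqd hce
            obtain ⟨ngf', ngf⟩ := h.far_four t2.symm h3 h4 h5 hg hce hdf
            -- A second neighbour `q` of `g` sees only the end `g` of the path `g r d e`, and `f`
            -- sees only `e`; so `q = f`, but `f` is not adjacent to `g`.
            have key := hG.eq_of_isEndPartner (G := G) (a := g) (b := r) (c := d) (d := e)
              (v := q) (w := f)
              ⟨h.1 t2.symm, h.1 h3, h.1 h4, fun h => hgn h.symm, nge, nce⟩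
              ⟨hq.ne', hqc, nqd, nqe', by simp [hq.symm, nqe]⟩
              ⟨ngf'.symm, ncf'.symm, hdf.symm, h5.ne', by
                simp [(h.1 h5).symm, G.adj_comm f g, ngf]⟩
            exact ngf (key ▸ hq)
          · exact no6 r t hr
      · rintro rfl
        exact h.1 t2.symm
    · have := h.chords_of_six hG h1 h2 h3 t1 t2 hac hbd hm n1
      tauto
  · by_cases hm : c = m
    · subst hm
      have hch := h.chords_of_six hG t3.symm t2.symm h3 h4 h5 n2.symm n1.symm hce hdf
      refine ⟨k, fun q => ⟨fun hq => ?_, ?_⟩, c, n2, h.1 t2.symm⟩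
      · by_contra hqk
        have no6 : ∀ r, T.Adj g r → r ≠ k → False := fun r t hr =>
          no7 r g k t.symm t3.symm t2.symm hr n2.symm n1.symm
        rcases h.adj_or_exists hq with t | ⟨r, t, t'⟩
        · exact no6 q t hqk
        · by_cases hr : r = k
          · subst hr
            have nqc : q ≠ c := by rintro rfl; tauto
            obtain ⟨nqd', nqd⟩ := h.far_three t'.symm t2.symm h3 nqc n1.symm
            obtain ⟨nqe', nqe⟩ := h.far_four t'.symm t2.symm h3 h4 nqc n1.symm hce
            obtain ⟨nge', nge⟩ := h.far_four t3.symm t2.symm h3 h4 n2.symm n1.symm hce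
            obtain ⟨nke', nke⟩ := h.far_three t2.symm h3 h4 n1.symm hce
            obtain ⟨nkf', nkf⟩ := h.far_four t2.symm h3 h4 h5 n1.symm hce hdf
            obtain ⟨ngf', ngf⟩ := h.far_five t3.symm t2.symm h3 h4 h5 n2.symm n1.symm hce hdf
            have key := hG.eq_of_isEndPartner (G := G) (a := g) (b := r) (c := d) (d := e)
              (v := q) (w := f)
              ⟨h.1 t3.symm, by tauto, h.1 h4, fun h => hgn h.symm, nge, nke⟩
              ⟨hq.ne', hqk, nqd', nqe', by simp [hq.symm, nqe]⟩
              ⟨ngf'.symm, nkf'.symm, hdf.symm, h5.ne', by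
                simp [(h.1 h5).symm, G.adj_comm f g, ngf]⟩
            exact ngf (key ▸ hq)
          · exact no6 r t hr
      · rintro rfl
        exact h.1 t3.symm
    · exact (h.not_path_seven hG h1 h2 h3 t1 t2 t3 hac hbd hm n1 n2).elim
  · by_cases hm : c = m
    · subst hm
      exact (no7 r l k t4.symm t3.symm t2.symm n3.symm n2.symm n1.symm).elim
    · exact (h.not_path_seven hG h1 h2 h3 t1 t2 t3 hac hbd hm n1 n2).elim

/-- If `c` is not a hub, some `w` at depth two below `u` has a second neighbour `w'`, again a child
of `u`. Then `u` is a hub: for `g` outside its closed neighbourhood, with tree parent `p`, the path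
`w u p g` is induced and `w'` is a partner of its end `w`, so `g` cannot have a second neighbour
acting as a partner of the other end. -/
theorem exists_isHub_of_depth_two [DecidableEq V] (h : G.IsTreeSpanner T 2) (hG : G.IsP4Tidy)
    {c : V} (hno : ∀ m k l, T.Adj c m → T.Adj m k → T.Adj k l → c ≠ k → m ≠ l → False) :
    ∃ c, G.IsHub c := by
  have cov : ∀ g, g = c ∨ T.Adj c g ∨ ∃ m, T.Adj c m ∧ T.Adj m g ∧ c ≠ g := by
    intro g
    rcases h.path_cases c g with t | t | t | ⟨m, k, t1, t2, t3, n1, n2⟩ |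
      ⟨m, k, l, r, t1, t2, t3, t4, n1, n2, n3⟩
    · exact .inl t
    · exact .inr (.inl t)
    · exact .inr (.inr t)
    · exact (hno _ _ _ t1 t2 t3 n1 n2).elim
    · exact (hno _ _ _ t1 t2 t3 n1 n2).elim
  have nbr : ∀ {m g q}, T.Adj c m → T.Adj m g → c ≠ g → G.Adj g q → q ≠ m → T.Adj m q := by
    intro m g q t1 t2 n hq hqm
    rcases h.adj_or_exists hq with t | ⟨r, t, t'⟩
    · exact (hno _ _ _ t1 t2 t n hqm.symm).elim
    · by_cases hr : r = m
      · exact hr ▸ t'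
      · exact (hno _ _ _ t1 t2 t n (Ne.symm hr)).elim
  by_cases hc : G.IsHub c
  · exact ⟨c, hc⟩
  unfold IsHub IsPendant at hc
  push Not at hc
  obtain ⟨w, hwc, hcw, hw⟩ := hc
  rcases cov w with t | t | ⟨u, tu, tw, -⟩
  · exact absurd t hwc
  · exact absurd (h.1 t) hcw
  obtain ⟨w', hw', hwu⟩ : ∃ q, G.Adj w q ∧ q ≠ u := by
    by_contra hq
    push Not at hq
    exact hwc.symm (hw u (fun q => ⟨hq q, fun e => e ▸ h.1 tw.symm⟩) c |> fun H => by
      by_contra hne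
      exact H hne (h.1 tu.symm))
  have tw' : T.Adj u w' := nbr tu tw hwc.symm hw' hwu
  have hwc' : w' ≠ c := by rintro rfl; exact hcw hw'.symm
  have hcw' : ¬G.Adj w c := fun h => hcw h.symm
  refine ⟨u, fun g hgu hug => ?_⟩
  rcases cov g with rfl | tg | ⟨m, tm, tg, hcg⟩
  · exact absurd (h.1 tu.symm) hug
  · refine ⟨c, fun q => ⟨fun hq => ?_, fun e => e ▸ (h.1 tg).symm⟩, u, hgu.symm, h.1 tu⟩
    by_contra hqc
    obtain ⟨f1, f2⟩ := h.far_three tw.symm tu.symm tg hwc hgu.symm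
    obtain ⟨f3, f4⟩ := h.far_three tw'.symm tu.symm tg hwc' hgu.symm
    have hqu : q ≠ u := by rintro rfl; exact hug hq.symm
    have hfar : w ≠ q ∧ ¬G.Adj w q ∧ w' ≠ q := by
      have : T.Adj c q ∨ T.Adj g q := by
        rcases h.adj_or_exists hq with t | ⟨r, t, t'⟩
        · exact .inr t
        · by_cases hr : r = c
          · exact .inl (hr ▸ t')
          · exact (hno _ _ _ tg t t' (Ne.symm hr) hq.ne).elim
      rcases this with t | t
      · obtain ⟨f5, f6⟩ := h.far_three tw.symm tu.symm t hwc hqu.symm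
        exact ⟨f5, f6, (h.far_three tw'.symm tu.symm t hwc' hqu.symm).1⟩
      · obtain ⟨f5, f6⟩ := h.far_four tw.symm tu.symm tg t hwc hgu.symm (Ne.symm hqc)
        exact ⟨f5, f6, (h.far_four tw'.symm tu.symm tg t hwc' hgu.symm (Ne.symm hqc)).1⟩
    refine hfar.2.2 (hG.eq_of_isEndPartner (G := G) (a := w) (b := u) (c := c) (d := g)
      ⟨h.1 tw.symm, h.1 tu.symm, h.1 tg, hcw', f2, hug⟩
      ⟨hw'.ne', tw'.ne', hwc', f3, by simp [hw'.symm, f4]⟩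
      ⟨hfar.1.symm, hqu, hqc, hq.ne', by simp [hq.symm, G.adj_comm q w, hfar.2.1]⟩)
  · have hmu : u ≠ m := by rintro rfl; exact hug (h.1 tg)
    refine ⟨m, fun q => ⟨fun hq => ?_, fun e => e ▸ (h.1 tg).symm⟩, c, hcg, h.1 tm.symm⟩
    by_contra hqm
    obtain ⟨f1, f2⟩ := h.far_three tw.symm tu.symm tm hwc hmu
    obtain ⟨f3, f4⟩ := h.far_three tw'.symm tu.symm tm hwc' hmu
    obtain ⟨f5, f6⟩ := h.far_four tw.symm tu.symm tm tg hwc hmu hcg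
    obtain ⟨f7, f8⟩ := h.far_four tw'.symm tu.symm tm tg hwc' hmu hcg
    -- Otherwise `w u c m` is an induced path with the distinct partners `w'` and `g`.
    have hum : G.Adj u m := by
      by_contra hum
      exact f7 (hG.eq_of_isEndPartner (G := G) (a := w) (b := u) (c := c) (d := m)
        ⟨h.1 tw.symm, h.1 tu.symm, h.1 tm, hcw', f2, hum⟩
        ⟨hw'.ne', tw'.ne', hwc', f3, by simp [hw'.symm, f4]⟩
        ⟨f5.symm, hgu, hcg.symm, tg.ne', by simp [(h.1 tg).symm, G.adj_comm g w, f6]⟩)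
    have tq : T.Adj m q := nbr tm tg hcg hq hqm
    have hqu : q ≠ u := by rintro rfl; exact hug hq.symm
    have hfar : w ≠ q ∧ ¬G.Adj w q ∧ w' ≠ q := by
      by_cases hqc : q = c
      · exact hqc ▸ ⟨hwc, hcw', hwc'⟩
      · obtain ⟨f9, f10⟩ := h.far_four tw.symm tu.symm tm tq hwc hmu (Ne.symm hqc)
        exact ⟨f9, f10, (h.far_four tw'.symm tu.symm tm tq hwc' hmu (Ne.symm hqc)).1⟩
    refine hfar.2.2 (hG.eq_of_isEndPartner (G := G) (a := w) (b := u) (c := m) (d := g)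
      ⟨h.1 tw.symm, hum, h.1 tg, f2, f6, hug⟩
      ⟨hw'.ne', tw'.ne', f3, f7, by simp [hw'.symm, f8]⟩
      ⟨hfar.1.symm, hqu, hqm, hq.ne', by simp [hq.symm, G.adj_comm q w, hfar.2.1]⟩)

theorem exists_isHub [DecidableEq V] (h : G.IsTreeSpanner T 2) (hG : G.IsP4Tidy) :
    ∃ c, G.IsHub c := by
  by_cases h6 : ∃ a b c d e f, T.Adj a b ∧ T.Adj b c ∧ T.Adj c d ∧ T.Adj d e ∧ T.Adj e f ∧
      a ≠ c ∧ b ≠ d ∧ c ≠ e ∧ d ≠ f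
  · obtain ⟨a, b, c, d, e, f, h1, h2, h3, h4, h5, n1, n2, n3, n4⟩ := h6
    rcases h.chords_of_six hG h1 h2 h3 h4 h5 n1 n2 n3 n4 with ⟨-, g1, g2, g3⟩ | ⟨g1, g2, g3, -⟩
    · exact ⟨d, h.isHub_of_six hG h1 h2 h3 h4 h5 n1 n2 n3 n4 g1 g2 g3⟩
    · exact ⟨c, h.isHub_of_six hG h5.symm h4.symm h3.symm h2.symm h1.symm n4.symm n3.symm n2.symm
        n1.symm g3.symm (fun h => g2 h.symm) g1.symm⟩
  by_cases h5 : ∃ a b c d e, T.Adj a b ∧ T.Adj b c ∧ T.Adj c d ∧ T.Adj d e ∧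
      a ≠ c ∧ b ≠ d ∧ c ≠ e
  · obtain ⟨a, b, c, d, e, h1, h2, h3, h4, n1, n2, n3⟩ := h5
    -- From the middle of a five-vertex path, a branch of length three together with the two edges
    -- on a side it avoids would be a six-vertex path.
    refine h.exists_isHub_of_depth_two hG (c := c) fun m k l t1 t2 t3 m1 m2 => h6 ?_
    by_cases hb : b = m
    · subst hb
      exact ⟨l, k, b, c, d, e, t3.symm, t2.symm, t1.symm, h3, h4, m2.symm, m1.symm, n2, n3⟩
    · exact ⟨a, b, c, m, k, l, h1, h2, t1, t2, t3, n1, hb, m1, m2⟩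
  by_cases h4 : ∃ a b c d, T.Adj a b ∧ T.Adj b c ∧ T.Adj c d ∧ a ≠ c ∧ b ≠ d
  · obtain ⟨a, b, c, d, h1, h2, h3, n1, n2⟩ := h4
    refine h.exists_isHub_of_depth_two hG (c := b) fun m k l t1 t2 t3 m1 m2 => h5 ?_
    by_cases ha : a = m
    · subst ha
      exact ⟨l, k, a, b, c, t3.symm, t2.symm, t1.symm, h2, m2.symm, m1.symm, n1⟩
    · exact ⟨a, b, m, k, l, h1, t1, t2, t3, ha, m1, m2⟩
  obtain ⟨c⟩ := h.2.1.connected.nonempty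
  exact h.exists_isHub_of_depth_two hG (c := c) fun m k l t1 t2 t3 m1 m2 =>
    h4 ⟨c, m, k, l, t1, t2, t3, m1, m2⟩

end IsTreeSpanner

end SimpleGraph

/-! ### From a hub to a tree 2-spanner -/

namespace SimpleGraph

variable {V : Type*}

/-- The graph in which every vertex other than `c` is joined to its image under `f`. -/
def parentGraph (c : V) (f : V → V) : SimpleGraph V where
  Adj u v := u ≠ v ∧ (u ≠ c ∧ f u = v ∨ v ≠ c ∧ f v = u)
  symm := ⟨fun _ _ h => ⟨h.1.symm, h.2.symm⟩⟩
  loopless := ⟨fun _ h => h.1 rfl⟩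

theorem parentGraph_adj {c : V} {f : V → V} {v : V} (hv : v ≠ c) (hf : f v ≠ v) :
    (parentGraph c f).Adj v (f v) :=
  ⟨hf.symm, .inl ⟨hv, rfl⟩⟩

/-- Every edge is `s(v, f v)` for some `v ≠ c`, so there are at most `|V| - 1` edges, and a
connected graph with so few edges is a tree. -/
theorem parentGraph_isTree [Finite V] {c : V} {f : V → V}
    (hconn : ∀ v, (parentGraph c f).Reachable c v) : (parentGraph c f).IsTree := by
  have hc : (parentGraph c f).Connected :=
    { preconnected := fun u v => (hconn u).symm.trans (hconn v)
      nonempty := ⟨c⟩ }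
  refine isTree_iff_connected_and_card.2 ⟨hc, le_antisymm ?_ hc.card_vert_le_card_edgeSet_add_one⟩
  have hsub : (parentGraph c f).edgeSet ⊆ (fun v => s(v, f v)) '' {c}ᶜ := by
    intro e
    induction e with
    | _ u v =>
      rintro ⟨-, ⟨h, e⟩ | ⟨h, e⟩⟩
      · exact ⟨u, h, congrArg (fun x => s(u, x)) e⟩
      · exact ⟨v, h, (congrArg (fun x => s(v, x)) e).trans Sym2.eq_swap⟩
  have h1 : Nat.card (parentGraph c f).edgeSet ≤ ({c}ᶜ : Set V).ncard := by
    rw [Nat.card_coe_set_eq]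
    exact (Set.ncard_le_ncard hsub (Set.toFinite _)).trans (Set.ncard_image_le (Set.toFinite _))
  have h2 := Set.ncard_add_ncard_compl ({c} : Set V)
  rw [Set.ncard_singleton] at h2
  omega

/-- The stretch bound for edges adds up along a shortest path of `G`. -/
theorem isTreeSpanner_of_adj {G T : SimpleGraph V} {t : ℕ} (hle : T ≤ G) (hT : T.IsTree)
    (h : ∀ u v, G.Adj u v → T.dist u v ≤ t) : G.IsTreeSpanner T t := by
  refine ⟨hle, hT, fun u v => ?_⟩
  obtain ⟨p, hp⟩ := (hT.connected.mono hle).exists_walk_length_eq_dist u v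
  rw [← hp]
  clear hp
  induction p with
  | nil => simp
  | cons hadj p ih =>
    refine (hT.connected.dist_triangle (v := _)).trans ((add_le_add (h _ _ hadj) ih).trans ?_)
    rw [Walk.length_cons]
    linarith

theorem IsHub.isAdmissible [Finite V] {G : SimpleGraph V} {c : V} (h : G.IsHub c) :
    G.IsAdmissible 2 := by
  classical
  unfold IsHub IsPendant at h
  choose! p hp hp' using h
  let f : V → V := fun v => if G.Adj c v then c else p v
  have hp1 : ∀ w, w ≠ c → ¬G.Adj c w → G.Adj w (p w) := fun w h1 h2 => (hp w h1 h2 _).2 rfl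
  -- Otherwise `p w` would be pendant too, although it has `w` and a further neighbour.
  have hpc : ∀ w, w ≠ c → ¬G.Adj c w → G.Adj c (p w) := by
    intro w h1 h2
    by_contra h3
    have h4 : p w ≠ c := fun e => h2 (e ▸ hp1 w h1 h2).symm
    obtain ⟨q, hq, hq'⟩ := hp' w h1 h2
    have e1 := (hp _ h4 h3 q).1 hq'
    have e2 := (hp _ h4 h3 w).1 (hp1 w h1 h2).symm
    exact hq (e1.trans e2.symm)
  have hf : ∀ v, v ≠ c → G.Adj v (f v) := by
    intro v hv
    by_cases hcv : G.Adj c v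
    · simpa [f, hcv] using hcv.symm
    · simpa [f, hcv] using hp1 v hv hcv
  have hfT : ∀ v, v ≠ c → (parentGraph c f).Adj v (f v) := fun v hv =>
    parentGraph_adj hv (hf v hv).ne'
  have hcT : ∀ v, G.Adj c v → (parentGraph c f).Adj c v := by
    intro v hv
    have := hfT v hv.ne'
    simp only [f, hv, if_true] at this
    exact this.symm
  have hpT : ∀ w, w ≠ c → ¬G.Adj c w → (parentGraph c f).Adj (p w) w := by
    intro w h1 h2
    have := hfT w h1
    simp only [f, h2, if_false] at this
    exact this.symm
  refine ⟨parentGraph c f, isTreeSpanner_of_adj ?_ (parentGraph_isTree ?_) ?_⟩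
  · rintro u v ⟨-, ⟨h, rfl⟩ | ⟨h, rfl⟩⟩
    · exact hf u h
    · exact (hf v h).symm
  · intro v
    by_cases hv : v = c
    · exact hv ▸ Reachable.refl _
    by_cases hcv : G.Adj c v
    · exact (hcT v hcv).reachable
    · exact (hcT _ (hpc v hv hcv)).reachable.trans (hpT v hv hcv).reachable
  · intro u v huv
    have one : ∀ {u v}, (parentGraph c f).Adj u v → (parentGraph c f).dist u v ≤ 2 := fun h => by
      rw [dist_eq_one_iff_adj.2 h]; norm_num
    by_cases hu : u = c
    · subst hu
      exact one (hcT v huv)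
    by_cases hv : v = c
    · subst hv
      exact one (hcT u huv.symm).symm
    by_cases hcu : G.Adj c u
    · by_cases hcv : G.Adj c v
      · exact dist_le (.cons (hcT u hcu).symm (.cons (hcT v hcv) .nil))
      · rw [(hp v hv hcv u).1 huv.symm]
        exact one (hpT v hv hcv)
    · have := (hp u hu hcu v).1 huv
      rw [this]
      exact one (hpT u hu hcu).symm

theorem IsP4Tidy.isAdmissible_two_iff [DecidableEq V] [Finite V] {G : SimpleGraph V}
    (hG : G.IsP4Tidy) : G.IsAdmissible 2 ↔ ∃ c, G.IsHub c :=
  ⟨fun ⟨_, hT⟩ => hT.exists_isHub hG, fun ⟨_, hc⟩ => hc.isAdmissible⟩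

end SimpleGraph

/-! ### The program -/

namespace RAM

/-- Decides whether some vertex is a hub. Register 1 holds `1`, register 2 the number `n` of
vertices, register 3 the address behind the input, where a table with an entry for every vertex
is kept, and register 4 runs through the vertices. The first loop counts the pendant vertices in
register 5 and the pendant vertices of every closed neighbourhood in the table; the second loop
looks for a hub. -/
def hubProgram : Program :=
  [.const 1 1,
   -- Register 0 is never written, so it holds the address 0, where `n` is stored.
   .load 2 0,
   .add 3 2 1,
   .load 3 3,
   -- line 4: head of the first loop
   .jumpLT 4 2 6,
   .jump 30,
   .add 6 4 1,
   .load 7 6,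
   .add 6 6 1,
   .load 8 6,
   .sub 8 8 7,
   .jumpLT 1 8 28,
   .jumpLT 8 1 28,
   .load 7 7,
   .add 6 7 1,
   .load 8 6,
   .add 6 6 1,
   .load 6 6,
   .sub 6 6 8,
   .jumpLT 1 6 21,
   .jump 28,
   .add 5 5 1,
   .add 6 4 3,
   -- Writing 1 instead of incrementing is right: no neighbour of a pendant vertex is pendant, so
   -- the old entry is 0.
   .store 6 1,
   .add 6 7 3,
   .load 8 6,
   .add 8 8 1,
   .store 6 8,
   .add 4 4 1,
   .jump 4,
   -- line 30: the second loop is prepared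
   .const 4 0,
   .sub 5 2 5,
   -- line 32: head of the second loop
   .jumpLT 4 2 34,
   .halt false,
   .add 6 4 1,
   .load 7 6,
   .add 6 6 1,
   .load 8 6,
   .sub 8 8 7,
   -- The vertex itself belongs to its closed neighbourhood.
   .add 8 8 1,
   .add 6 4 3,
   .load 6 6,
   .sub 8 8 6,
   .jumpLT 8 5 46,
   .jumpLT 5 8 46,
   .halt true,
   .add 4 4 1,
   .jump 32]

/-! ### Sizes of words -/

/-- Does not write to the registers 1 and 3, adds only their contents, and does not jump to the
first four instructions. -/
def Instr.Tame : Instr → Prop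
  | .const d k => d ≠ 1 ∧ d ≠ 3 ∧ k ≤ 1
  | .add d _ b => d ≠ 1 ∧ d ≠ 3 ∧ (b = 1 ∨ b = 3)
  | .sub d _ _ => d ≠ 1 ∧ d ≠ 3
  | .load d _ => d ≠ 1 ∧ d ≠ 3
  | .store _ _ => True
  | .jump l => 4 ≤ l
  | .jumpLT _ _ l => 4 ≤ l
  | .halt _ => True

theorem tame_of_mem_drop : ∀ i ∈ hubProgram.drop 4, i.Tame := by
  simp [hubProgram, Instr.Tame]

/-- The configuration is past the first four instructions, its words are at most `K`, and those in
the registers 1 and 3 at most `M`. -/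
def Config.Tame (s : Config) (K M : ℕ) : Prop :=
  4 ≤ s.pc ∧ s.reg 1 ≤ M ∧ s.reg 3 ≤ M ∧ ∀ i, s.reg i ≤ K ∧ s.mem i ≤ K

theorem update_le {f : ℕ → ℕ} {K K' d x : ℕ} (hf : ∀ i, f i ≤ K) (hK : K ≤ K') (hx : x ≤ K')
    (i : ℕ) : Function.update f d x i ≤ K' := by
  rw [Function.update_apply]
  split_ifs
  · exact hx
  · exact (hf i).trans hK

/-- The second summand of an addition is register 1 or 3, hence at most `M`; words therefore grow
linearly with time, instead of doubling. -/
theorem Instr.Tame.exec {i : Instr} (hi : i.Tame) {s : Config} {K M : ℕ} (hM : 1 ≤ M)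
    (hs : s.Tame K M) : (i.exec s).Tame (K + M) M := by
  obtain ⟨h1, h2, h3, h4⟩ := hs
  have hr : ∀ i, s.reg i ≤ K := fun i => (h4 i).1
  have hm : ∀ i, s.mem i ≤ K := fun i => (h4 i).2
  have hK : K ≤ K + M := Nat.le_add_right _ _
  have hm' : ∀ i, s.mem i ≤ K + M := fun i => (hm i).trans hK
  have hr' : ∀ i, s.reg i ≤ K + M := fun i => (hr i).trans hK
  have key : ∀ d x, d ≠ 1 → d ≠ 3 → x ≤ K + M →
      (⟨s.pc + 1, Function.update s.reg d x, s.mem⟩ : Config).Tame (K + M) M := by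
    intro d x hd1 hd3 hx
    refine ⟨by simp; omega, ?_, ?_, fun i => ⟨update_le hr hK hx i, hm' i⟩⟩
    · simpa [Function.update_of_ne hd1.symm] using h2
    · simpa [Function.update_of_ne hd3.symm] using h3
  match i, hi with
  | .const d k, ⟨hd1, hd3, hk⟩ => exact key d k hd1 hd3 (by omega)
  | .add d a b, ⟨hd1, hd3, hb⟩ =>
    refine key d _ hd1 hd3 (add_le_add (hr a) ?_)
    rcases hb with rfl | rfl <;> assumption
  | .sub d a b, ⟨hd1, hd3⟩ => exact key d _ hd1 hd3 ((Nat.sub_le _ _).trans (hr' a))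
  | .load d a, ⟨hd1, hd3⟩ => exact key d _ hd1 hd3 (hm' _)
  | .store a k, _ =>
    exact ⟨by simp [Instr.exec]; omega, h2, h3, fun i => ⟨hr' i, update_le hm hK (hr' k) i⟩⟩
  | .jump l, hl => exact ⟨hl, h2, h3, fun i => ⟨hr' i, hm' i⟩⟩
  | .jumpLT a b l, hl =>
    refine ⟨?_, h2, h3, fun i => ⟨hr' i, hm' i⟩⟩
    have hl : 4 ≤ l := hl
    simp only [Instr.exec]
    split_ifs <;> omega
  | .halt b, _ => exact ⟨h1, h2, h3, fun i => ⟨hr' i, hm' i⟩⟩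

theorem Config.Tame.step {s : Config} {K M : ℕ} (hM : 1 ≤ M) (hs : s.Tame K M) :
    (step hubProgram s).Tame (K + M) M := by
  unfold RAM.step
  split
  · rename_i i hi
    refine (tame_of_mem_drop i ?_).exec hM hs
    have h4 := hs.1
    refine List.mem_of_getElem? (i := s.pc - 4) ?_
    rw [List.getElem?_drop, ← hi]
    congr 1
    omega
  · obtain ⟨h1, h2, h3, h4⟩ := hs
    exact ⟨h1, h2, h3, fun i => ⟨by have := (h4 i).1; omega, by have := (h4 i).2; omega⟩⟩

/-- The configuration after the first four instructions. -/
theorem run_four (input : List ℕ) : run hubProgram input 4 =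
    ⟨4, Function.update (Function.update (Function.update (Function.update (fun _ => 0) 1 1) 2
      (input.getD 0 0)) 3 (input.getD 0 0 + 1)) 3 (input.getD (input.getD 0 0 + 1) 0),
      fun i => input.getD i 0⟩ :=
  rfl

theorem run_le {input : List ℕ} {M : ℕ} (hM : input.getD 0 0 + 1 ≤ M)
    (hin : ∀ i, input.getD i 0 ≤ M) (k i : ℕ) :
    (run hubProgram input k).reg i ≤ (k + 1) * M ∧
      (run hubProgram input k).mem i ≤ (k + 1) * M := by
  have h1 : 1 ≤ M := by omega
  have hle : ∀ k, M ≤ (k + 1) * M := fun k => Nat.le_mul_of_pos_left _ (by omega)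
  have r0 : ∀ i : ℕ, (fun _ : ℕ => 0) i ≤ M := fun _ => Nat.zero_le _
  have r1 := update_le (d := 1) (x := 1) r0 le_rfl h1
  have r2 := update_le (d := 2) (x := input.getD 0 0) r1 le_rfl (by omega)
  have r3 := update_le (d := 3) (x := input.getD 0 0 + 1) r2 le_rfl hM
  have r4 := update_le (d := 3) (x := input.getD (input.getD 0 0 + 1) 0) r3 le_rfl (hin _)
  have late : ∀ k, (run hubProgram input (k + 4)).Tame ((k + 1) * M) M := by
    intro k
    induction k with
    | zero =>
      rw [Nat.zero_add, run_four, Nat.zero_add, one_mul]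
      exact ⟨le_rfl, r4 1, r4 3, fun i => ⟨r4 i, hin i⟩⟩
    | succ k ih =>
      have : run hubProgram input (k + 1 + 4) = step hubProgram (run hubProgram input (k + 4)) :=
        Function.iterate_succ_apply' _ (k + 4) _
      rw [this, add_mul (k + 1), one_mul]
      exact ih.step h1
  match k with
  | 0 => exact ⟨(r0 i).trans (hle _), (hin i).trans (hle _)⟩
  | 1 => exact ⟨(r1 i).trans (hle _), (hin i).trans (hle _)⟩
  | 2 => exact ⟨(r2 i).trans (hle _), (hin i).trans (hle _)⟩
  | 3 => exact ⟨(r3 i).trans (hle _), (hin i).trans (hle _)⟩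
  | k + 4 =>
    obtain ⟨h2, h3⟩ := (late k).2.2.2 i
    have : (k + 1) * M ≤ (k + 4 + 1) * M := Nat.mul_le_mul_right _ (by omega)
    exact ⟨h2.trans this, h3.trans this⟩

theorem run_eq_of_halt {P : Program} {input : List ℕ} {j k : ℕ} {b : Bool}
    (h : P[(run P input j).pc]? = some (Instr.halt b)) (hjk : j ≤ k) :
    run P input k = run P input j := by
  have hfix : step P (run P input j) = run P input j := by
    conv_lhs => unfold step
    rw [h]
    rfl
  obtain ⟨d, rfl⟩ := Nat.exists_eq_add_of_le' hjk
  unfold run at *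
  rw [Function.iterate_add_apply, Function.iterate_fixed hfix]

/-! ### Running the program -/

/-- `P` leads from the configuration `s` to `t` in at most `k` steps. -/
def Reaches (P : Program) (k : ℕ) (s t : Config) : Prop :=
  ∃ j ≤ k, (step P)^[j] s = t

theorem Reaches.trans {P : Program} {k l : ℕ} {s t u : Config} (h : Reaches P k s t)
    (h' : Reaches P l t u) : Reaches P (k + l) s u := by
  obtain ⟨i, hi, rfl⟩ := h
  obtain ⟨j, hj, rfl⟩ := h'
  exact ⟨j + i, by omega, Function.iterate_add_apply _ _ _ _⟩

theorem Reaches.mono {P : Program} {k l : ℕ} {s t : Config} (h : Reaches P k s t) (hkl : k ≤ l) :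
    Reaches P l s t := by
  obtain ⟨i, hi, e⟩ := h
  exact ⟨i, hi.trans hkl, e⟩

theorem reaches_step (P : Program) (s : Config) : Reaches P 1 s (step P s) :=
  ⟨1, le_rfl, rfl⟩

variable (r m : ℕ → ℕ)

theorem reaches_jumpLT {P : Program} {pc a b l : ℕ} (h : P[pc]? = some (.jumpLT a b l)) :
    Reaches P 1 ⟨pc, r, m⟩ ⟨if r a < r b then l else pc + 1, r, m⟩ := by
  have : step P ⟨pc, r, m⟩ = ⟨if r a < r b then l else pc + 1, r, m⟩ := by
    simp only [step, h]
    rfl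
  exact this ▸ reaches_step P _

theorem reaches_jump {P : Program} {pc l : ℕ} (h : P[pc]? = some (.jump l)) :
    Reaches P 1 ⟨pc, r, m⟩ ⟨l, r, m⟩ := by
  have : step P ⟨pc, r, m⟩ = ⟨l, r, m⟩ := by
    simp only [step, h]
    rfl
  exact this ▸ reaches_step P _

/-- Blocks without jumps are evaluated by `rfl` with symbolic registers and memory, the program
counter being a literal. -/
theorem reaches_degree : ∃ r', Reaches hubProgram 5 ⟨6, r, m⟩ ⟨11, r', m⟩ ∧
    (∀ i < 6, r' i = r i) ∧ r' 7 = m (r 4 + r 1) ∧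
    r' 8 = m (r 4 + r 1 + r 1) - m (r 4 + r 1) := by
  refine ⟨_, ⟨5, le_rfl, rfl⟩, ?_, rfl, rfl⟩
  intro i hi
  interval_cases i <;> rfl

theorem reaches_degree_neighbour : ∃ r', Reaches hubProgram 6 ⟨13, r, m⟩ ⟨19, r', m⟩ ∧
    (∀ i < 6, r' i = r i) ∧ r' 7 = m (r 7) ∧
    r' 6 = m (m (r 7) + r 1 + r 1) - m (m (r 7) + r 1) := by
  refine ⟨_, ⟨6, le_rfl, rfl⟩, ?_, rfl, rfl⟩
  intro i hi
  interval_cases i <;> rfl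

theorem reaches_count : ∃ r', Reaches hubProgram 7 ⟨21, r, m⟩
    ⟨28, r', Function.update (Function.update m (r 4 + r 3) (r 1)) (r 7 + r 3)
      (Function.update m (r 4 + r 3) (r 1) (r 7 + r 3) + r 1)⟩ ∧
    (∀ i < 5, r' i = r i) ∧ r' 5 = r 5 + r 1 := by
  refine ⟨_, ⟨7, le_rfl, rfl⟩, ?_, rfl⟩
  intro i hi
  interval_cases i <;> rfl

theorem reaches_next₁ : ∃ r', Reaches hubProgram 2 ⟨28, r, m⟩ ⟨4, r', m⟩ ∧
    (∀ i < 4, r' i = r i) ∧ r' 4 = r 4 + r 1 ∧ r' 5 = r 5 := by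
  refine ⟨_, ⟨2, le_rfl, rfl⟩, ?_, rfl, rfl⟩
  intro i hi
  interval_cases i <;> rfl

theorem reaches_between : ∃ r', Reaches hubProgram 2 ⟨30, r, m⟩ ⟨32, r', m⟩ ∧
    (∀ i < 4, r' i = r i) ∧ r' 4 = 0 ∧ r' 5 = r 2 - r 5 := by
  refine ⟨_, ⟨2, le_rfl, rfl⟩, ?_, rfl, rfl⟩
  intro i hi
  interval_cases i <;> rfl

theorem reaches_test : ∃ r', Reaches hubProgram 9 ⟨34, r, m⟩ ⟨43, r', m⟩ ∧
    (∀ i < 6, r' i = r i) ∧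
    r' 8 = m (r 4 + r 1 + r 1) - m (r 4 + r 1) + r 1 - m (r 4 + r 3) := by
  refine ⟨_, ⟨9, le_rfl, rfl⟩, ?_, rfl⟩
  intro i hi
  interval_cases i <;> rfl

theorem reaches_next₂ : ∃ r', Reaches hubProgram 2 ⟨46, r, m⟩ ⟨32, r', m⟩ ∧
    (∀ i < 4, r' i = r i) ∧ r' 4 = r 4 + r 1 ∧ r' 5 = r 5 := by
  refine ⟨_, ⟨2, le_rfl, rfl⟩, ?_, rfl, rfl⟩
  intro i hi
  interval_cases i <;> rfl

end RAM

/-! ### Reading the input -/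

section Input

variable {n : ℕ} (L : Fin n → List (Fin n))

/-- The entry of the address table for `k`. -/
def tableEntry (k : ℕ) : ℕ :=
  n + 2 + ∑ v : Fin n, if (v : ℕ) < k then (L v).length else 0

theorem tableEntry_succ (v : Fin n) :
    tableEntry L (v + 1) = tableEntry L v + (L v).length := by
  unfold tableEntry
  have : ∀ u : Fin n, (if (u : ℕ) < v + 1 then (L u).length else 0) =
      (if (u : ℕ) < v then (L u).length else 0) + if u = v then (L u).length else 0 := by
    intro u
    rcases lt_trichotomy u v with h | h | h
    · have := Fin.lt_def.1 h
      simp [this, h.ne, this.trans (Nat.lt_succ_self _)]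
    · simp [h]
    · have := Fin.lt_def.1 h
      simp [h.ne', not_lt.2 this.le, not_lt.2 (Nat.succ_le_of_lt this)]
  simp only [this, Finset.sum_add_distrib, Finset.sum_ite_eq', Finset.mem_univ, if_true]
  ring

theorem tableEntry_mono {k l : ℕ} (h : k ≤ l) : tableEntry L k ≤ tableEntry L l := by
  unfold tableEntry
  refine Nat.add_le_add_left (Finset.sum_le_sum fun v _ => ?_) _
  split_ifs <;> omega

theorem input_getD_zero : (adjListInput L).getD 0 0 = n := by
  simp [adjListInput]

theorem input_getD_table {k : ℕ} (hk : k ≤ n) :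
    (adjListInput L).getD (k + 1) 0 = tableEntry L k := by
  unfold adjListInput
  rw [List.getD_append _ _ _ _ (by simp; omega), List.getD_append_right _ _ _ _ (by simp)]
  simp [List.getD_eq_getElem?_getD, Nat.lt_succ_of_le hk, tableEntry]

theorem input_length : (adjListInput L).length = tableEntry L n := by
  simp [adjListInput, tableEntry, Function.comp_def, List.sum_ofFn]
  ring

theorem input_getD_list {v p : Fin n} (h : L v = [p]) :
    (adjListInput L).getD (tableEntry L v) 0 = p := by
  unfold adjListInput
  rw [List.getD_append_right _ _ _ _ (by simp [tableEntry])]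
  set ls : List (List ℕ) := List.ofFn fun v : Fin n => (L v).map fun w : Fin n => (w : ℕ) with hls
  have hsum : ((ls.map List.length).take v).sum = tableEntry L v - (n + 2) := by
    rw [hls, List.map_ofFn, List.sum_take_ofFn, Finset.sum_filter]
    simp [tableEntry]
  have hdrop := List.drop_sum_flatten ls v
  -- After the entries of the earlier lists are dropped, what remains starts with the list of `v`.
  have hlen : (v : ℕ) < ls.length := by simp [hls]
  rw [hsum, List.drop_eq_getElem_cons hlen, List.flatten_cons] at hdrop
  have hv : ls[(v : ℕ)] = [(p : ℕ)] := by simp [hls, h]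
  rw [hv] at hdrop
  have hidx : tableEntry L v - ([n] ++ List.map (fun k => n + 2 + ∑ v : Fin n,
      if (v : ℕ) < k then (L v).length else 0) (List.range (n + 1))).length =
        tableEntry L v - (n + 2) := by
    simp
  have h0 := congrArg (fun l => l[0]?) hdrop
  simp only [List.getElem?_drop, Nat.add_zero] at h0
  rw [List.getD_eq_getElem?_getD, hidx, h0]
  rfl

theorem input_getD_le (hL : ∀ v, (L v).length ≤ n) (i : ℕ) :
    (adjListInput L).getD i 0 ≤ (n + 2) ^ 2 := by
  have htab : ∀ k, tableEntry L k ≤ (n + 2) ^ 2 := by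
    intro k
    have : (∑ v : Fin n, if (v : ℕ) < k then (L v).length else 0) ≤ ∑ _v : Fin n, n := by
      refine Finset.sum_le_sum fun v _ => ?_
      split_ifs
      · exact hL v
      · exact Nat.zero_le _
    simp at this
    unfold tableEntry
    nlinarith
  by_cases hi : i < (adjListInput L).length
  · rw [List.getD_eq_getElem _ _ hi]
    have hmem := List.getElem_mem hi
    unfold adjListInput at hmem
    simp only [List.mem_append, List.mem_singleton, List.mem_map, List.mem_flatten,
      List.mem_ofFn] at hmem
    rcases hmem with (h | ⟨k, -, h⟩) | ⟨l, ⟨v, rfl⟩, hl⟩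
    · change (adjListInput L)[i] = n at h
      rw [h]
      nlinarith
    · exact h ▸ htab k
    · obtain ⟨w, -, hw⟩ := List.mem_map.1 hl
      change (w : ℕ) = (adjListInput L)[i] at hw
      rw [← hw]
      have := w.2
      nlinarith
  · rw [List.getD_eq_default _ _ (not_lt.1 hi)]
    exact Nat.zero_le _

end Input

/-! ### Counting pendant vertices -/

namespace SimpleGraph

variable {n : ℕ} (G : SimpleGraph (Fin n))

open Classical in
/-- The number of pendant vertices below `k`. -/
noncomputable def numPendant (k : ℕ) : ℕ :=
  (Finset.univ.filter fun u : Fin n => (u : ℕ) < k ∧ G.IsPendant u).card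

open Classical in
/-- The number of pendant vertices below `k` in the closed neighbourhood of `x`. -/
noncomputable def numPendantNear (k : ℕ) (x : Fin n) : ℕ :=
  (Finset.univ.filter fun u : Fin n =>
    (u : ℕ) < k ∧ G.IsPendant u ∧ (u = x ∨ G.Adj u x)).card

variable {G}

theorem numPendant_zero : G.numPendant 0 = 0 := by simp [numPendant]

theorem numPendantNear_zero (x : Fin n) : G.numPendantNear 0 x = 0 := by simp [numPendantNear]

theorem val_lt_succ_iff (u v : Fin n) : (u : ℕ) < v + 1 ↔ u = v ∨ (u : ℕ) < v := by
  rw [Nat.lt_succ_iff_lt_or_eq, or_comm, Fin.ext_iff]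

theorem numPendant_succ_of_not {v : Fin n} (hv : ¬G.IsPendant v) :
    G.numPendant (v + 1) = G.numPendant v := by
  classical
  unfold numPendant
  congr 1
  ext u
  simp only [Finset.mem_filter, val_lt_succ_iff]
  grind

theorem numPendantNear_succ_of_not {v : Fin n} (x : Fin n)
    (hv : ¬(G.IsPendant v ∧ (v = x ∨ G.Adj v x))) :
    G.numPendantNear (v + 1) x = G.numPendantNear v x := by
  classical
  unfold numPendantNear
  congr 1
  ext u
  simp only [Finset.mem_filter, val_lt_succ_iff]
  grind

theorem numPendant_succ {v : Fin n} (hv : G.IsPendant v) :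
    G.numPendant (v + 1) = G.numPendant v + 1 := by
  classical
  unfold numPendant
  rw [← Finset.card_insert_of_notMem (a := v) (by simp)]
  congr 1
  ext u
  simp only [Finset.mem_filter, Finset.mem_insert, val_lt_succ_iff, Finset.mem_univ, true_and]
  grind

theorem numPendantNear_succ {v x : Fin n} (hv : G.IsPendant v) (hx : v = x ∨ G.Adj v x) :
    G.numPendantNear (v + 1) x = G.numPendantNear v x + 1 := by
  classical
  unfold numPendantNear
  rw [← Finset.card_insert_of_notMem (a := v) (by simp)]
  congr 1
  ext u
  simp only [Finset.mem_filter, Finset.mem_insert, val_lt_succ_iff, Finset.mem_univ, true_and]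
  grind

/-- A pendant vertex is not adjacent to a pendant vertex. -/
theorem IsPendant.not_isPendant {V : Type*} {G : SimpleGraph V} {u v : V} (hu : G.IsPendant u)
    (hv : G.IsPendant v) : ¬G.Adj u v := by
  intro h
  obtain ⟨p, hp, q, hq, hpq⟩ := hu
  obtain ⟨p', hp', -⟩ := hv
  have e1 := (hp v).1 h
  subst e1
  exact hq (((hp' q).1 hpq).trans ((hp' u).1 h.symm).symm)

/-- This justifies overwriting the table entry of `v` with 1. -/
theorem IsPendant.numPendantNear_self {v : Fin n} (hv : G.IsPendant v) :
    G.numPendantNear v v = 0 := by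
  classical
  unfold numPendantNear
  rw [Finset.card_eq_zero, Finset.filter_eq_empty_iff]
  rintro u - ⟨h1, h2, rfl | h3⟩
  · exact lt_irrefl _ h1
  · exact h2.not_isPendant hv h3

variable {L : Fin n → List (Fin n)}

theorem IsAdjList.isPendant_iff (hL : G.IsAdjList L) {v : Fin n} :
    G.IsPendant v ↔ ∃ p, L v = [p] ∧ 1 < (L p).length := by
  constructor
  · rintro ⟨p, hp, q, hq, hpq⟩
    have hmem : ∀ w, w ∈ L v ↔ w = p := fun w => ((hL v).2 w).trans (hp w)
    refine ⟨p, ?_, ?_⟩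
    · exact List.perm_singleton.1 ((List.perm_ext_iff_of_nodup (hL v).1 (by simp)).2
        (by simpa using hmem))
    · have h1 : v ∈ L p := ((hL p).2 v).2 ((hp p).2 rfl).symm
      have h2 : q ∈ L p := ((hL p).2 q).2 hpq
      by_contra hlen
      match hLp : L p with
      | [] => simp [hLp] at h1
      | [x] =>
        rw [hLp, List.mem_singleton] at h1 h2
        exact hq (h2.trans h1.symm)
      | x :: y :: l => simp [hLp] at hlen
  · rintro ⟨p, hp, hlen⟩
    refine ⟨p, fun q => by rw [← (hL v).2, hp, List.mem_singleton], ?_⟩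
    have hnd := (hL p).1
    match hLp : L p with
    | [] => simp [hLp] at hlen
    | [x] => simp [hLp] at hlen
    | x :: y :: l =>
      have hx : G.Adj p x := ((hL p).2 x).1 (by simp [hLp])
      have hy : G.Adj p y := ((hL p).2 y).1 (by simp [hLp])
      rw [hLp] at hnd
      by_cases hxv : x = v
      · refine ⟨y, ?_, hy⟩
        rintro rfl
        simp [hxv] at hnd
      · exact ⟨x, hxv, hx⟩

/-- Both sides count non-pendant vertices, in the closed neighbourhood of `v` and in the whole
graph. One set contains the other, so equal cardinalities mean equal sets. -/
theorem IsAdjList.isHub_iff (hL : G.IsAdjList L) (v : Fin n) :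
    (L v).length + 1 - G.numPendantNear n v = n - G.numPendant n ↔ G.IsHub v := by
  classical
  set N : Finset (Fin n) := insert v (L v).toFinset with hN
  have hmem : ∀ w, w ∈ N ↔ w = v ∨ G.Adj v w := by
    intro w
    rw [hN, Finset.mem_insert, List.mem_toFinset, (hL v).2]
  have hcard : N.card = (L v).length + 1 := by
    rw [hN, Finset.card_insert_of_notMem, List.toFinset_card_of_nodup (hL v).1]
    rw [List.mem_toFinset, (hL v).2]
    exact G.loopless.irrefl v
  have h1 : G.numPendantNear n v = (N.filter fun u => G.IsPendant u).card := by
    unfold numPendantNear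
    congr 1
    ext u
    simp only [Finset.mem_filter, hmem, Finset.mem_univ, u.2, true_and, G.adj_comm u v]
    tauto
  have h2 : G.numPendant n = (Finset.univ.filter fun u => G.IsPendant u).card := by
    unfold numPendant
    congr 1
    ext u
    simp
  have h3 := Finset.card_filter_add_card_filter_not (s := N) (fun u => G.IsPendant u)
  have h4 := Finset.card_filter_add_card_filter_not (s := (Finset.univ : Finset (Fin n)))
    (fun u => G.IsPendant u)
  rw [Finset.card_univ, Fintype.card_fin] at h4
  have hsub : (N.filter fun u => ¬G.IsPendant u) ⊆
      Finset.univ.filter fun u => ¬G.IsPendant u :=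
    Finset.filter_subset_filter _ (Finset.subset_univ _)
  have h5 : (L v).length + 1 - G.numPendantNear n v =
      (N.filter fun u => ¬G.IsPendant u).card := by omega
  have h6 : n - G.numPendant n = (Finset.univ.filter fun u => ¬G.IsPendant u).card := by omega
  rw [h5, h6]
  constructor
  · intro h w hw hvw
    by_contra hp
    have := Finset.eq_of_subset_of_card_le hsub h.ge
    have hwN : w ∈ N.filter fun u => ¬G.IsPendant u := by
      rw [this]
      simpa using hp
    rcases (hmem w).1 (Finset.mem_filter.1 hwN).1 with h | h
    · exact hw h
    · exact hvw h
  · intro h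
    congr 1
    refine hsub.antisymm fun w hw => ?_
    have hw := (Finset.mem_filter.1 hw).2
    refine Finset.mem_filter.2 ⟨(hmem w).2 ?_, hw⟩
    by_contra hc
    push Not at hc
    exact hw (h w hc.1 hc.2)

end SimpleGraph

/-! ### Correctness of the program -/

namespace RAM

variable {n : ℕ} {G : SimpleGraph (Fin n)} {L : Fin n → List (Fin n)}

/-- The memory contains the input, followed by the numbers of pendant vertices below `k` in the
closed neighbourhoods. -/
structure MemInv (G : SimpleGraph (Fin n)) (L : Fin n → List (Fin n)) (k : ℕ) (m : ℕ → ℕ) :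
    Prop where
  input : ∀ a < tableEntry L n, m a = (adjListInput L).getD a 0
  near : ∀ x : Fin n, m (x + tableEntry L n) = G.numPendantNear k x

/-- The registers 1 to 4 hold `1`, the number of vertices, the address behind the input and `k`. -/
structure RegInv (L : Fin n → List (Fin n)) (k : ℕ) (r : ℕ → ℕ) : Prop where
  one : r 1 = 1
  size : r 2 = n
  base : r 3 = tableEntry L n
  vertex : r 4 = k

theorem RegInv.congr {k : ℕ} {r r' : ℕ → ℕ} (h : RegInv L k r) (hr : ∀ i < 5, r' i = r i) :
    RegInv L k r' :=
  ⟨(hr 1 (by norm_num)).trans h.one, (hr 2 (by norm_num)).trans h.size,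
    (hr 3 (by norm_num)).trans h.base, (hr 4 (by norm_num)).trans h.vertex⟩

theorem RegInv.next {k l : ℕ} {r r' : ℕ → ℕ} (h : RegInv L k r) (hr : ∀ i < 4, r' i = r i)
    (h4 : r' 4 = l) : RegInv L l r' :=
  ⟨(hr 1 (by norm_num)).trans h.one, (hr 2 (by norm_num)).trans h.size,
    (hr 3 (by norm_num)).trans h.base, h4⟩

theorem lt_tableEntry (k : ℕ) (hk : k ≤ n) : k + 1 < tableEntry L n := by
  unfold tableEntry
  omega

theorem MemInv.table {k l : ℕ} {m : ℕ → ℕ} (h : MemInv G L k m) (hl : l ≤ n) :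
    m (l + 1) = tableEntry L l := by
  rw [h.input _ (lt_tableEntry l hl), input_getD_table L hl]

theorem MemInv.degree {k : ℕ} {m : ℕ → ℕ} (h : MemInv G L k m) (v : Fin n) :
    m ((v : ℕ) + 1 + 1) - m ((v : ℕ) + 1) = (L v).length := by
  rw [h.table v.2.le, h.table (Nat.succ_le_of_lt v.2), tableEntry_succ]
  omega

theorem MemInv.neighbour {k : ℕ} {m : ℕ → ℕ} (h : MemInv G L k m) {v p : Fin n}
    (hp : L v = [p]) : m (tableEntry L v) = p := by
  rw [h.input, input_getD_list L hp]
  have h1 := tableEntry_succ L v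
  have h2 := tableEntry_mono L (Nat.succ_le_of_lt v.2)
  rw [hp, List.length_singleton] at h1
  rw [← Nat.succ_eq_add_one] at h1
  omega

/-- What holds at the head of the first loop, before the vertex `k` is treated. -/
structure CountInv (G : SimpleGraph (Fin n)) (L : Fin n → List (Fin n)) (k : ℕ)
    (r m : ℕ → ℕ) : Prop where
  reg : RegInv L k r
  mem : MemInv G L k m
  count : r 5 = G.numPendant k

theorem countInv_run_four : ∃ r m, run hubProgram (adjListInput L) 4 = ⟨4, r, m⟩ ∧
    CountInv G L 0 r m := by
  have h0 := input_getD_zero L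
  refine ⟨_, _, run_four _, ⟨rfl, h0, ?_, rfl⟩, ⟨fun a _ => rfl, fun x => ?_⟩,
    SimpleGraph.numPendant_zero.symm⟩
  · change (adjListInput L).getD ((adjListInput L).getD 0 0 + 1) 0 = _
    rw [h0, input_getD_table L le_rfl]
  · rw [SimpleGraph.numPendantNear_zero]
    -- Memory behind the input is initially 0, so the table needs no initialisation.
    exact List.getD_eq_default _ _ (by rw [input_length]; omega)

/-- A vertex that is not pendant is passed over. -/
theorem CountInv.skip {v : Fin n} {r m r₀ : ℕ → ℕ} (h : CountInv G L v r₀ m)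
    (hv : ¬G.IsPendant v) (hr : ∀ i < 6, r i = r₀ i) :
    ∃ r', Reaches hubProgram 2 ⟨28, r, m⟩ ⟨4, r', m⟩ ∧ CountInv G L (v + 1) r' m := by
  obtain ⟨r', hreach, h4, e4, e5⟩ := reaches_next₁ r m
  have hreg := h.reg.congr (r' := r) fun i hi => hr i (by omega)
  refine ⟨r', hreach, hreg.next h4 (by rw [e4, hreg.vertex, hreg.one]), ⟨h.mem.input, ?_⟩, ?_⟩
  · intro x
    rw [SimpleGraph.numPendantNear_succ_of_not x fun hx => hv hx.1, h.mem.near]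
  · rw [e5, hr 5 (by norm_num), h.count, SimpleGraph.numPendant_succ_of_not hv]

/-- The table after a pendant vertex `v` with the neighbour `p` has been treated. -/
theorem MemInv.update {v p : Fin n} {m : ℕ → ℕ} (h : MemInv G L v m) (hL : G.IsAdjList L)
    (hv : G.IsPendant v) (hp : L v = [p]) :
    MemInv G L (v + 1) (Function.update (Function.update m (v + tableEntry L n) 1)
      (p + tableEntry L n)
      (Function.update m (v + tableEntry L n) 1 (p + tableEntry L n) + 1)) := by
  have hadj : ∀ x, G.Adj v x ↔ x = p := fun x => by rw [← (hL v).2, hp, List.mem_singleton]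
  have hpv : p ≠ v := ((hadj p).2 rfl).ne'
  have hpv' : (p : ℕ) + tableEntry L n ≠ v + tableEntry L n := fun e =>
    hpv (Fin.ext (Nat.add_right_cancel e))
  refine ⟨fun a ha => ?_, fun x => ?_⟩
  · rw [Function.update_of_ne (by omega), Function.update_of_ne (by omega), h.input a ha]
  · by_cases hxp : x = p
    · subst hxp
      rw [Function.update_self, Function.update_of_ne hpv', h.near,
        SimpleGraph.numPendantNear_succ hv (.inr ((hadj x).2 rfl))]
    have hxp' : (x : ℕ) + tableEntry L n ≠ p + tableEntry L n := fun e =>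
      hxp (Fin.ext (Nat.add_right_cancel e))
    rw [Function.update_of_ne hxp']
    by_cases hxv : x = v
    · subst hxv
      rw [Function.update_self, SimpleGraph.numPendantNear_succ hv (.inl rfl),
        hv.numPendantNear_self]
    have hxv' : (x : ℕ) + tableEntry L n ≠ v + tableEntry L n := fun e =>
      hxv (Fin.ext (Nat.add_right_cancel e))
    rw [Function.update_of_ne hxv', h.near, SimpleGraph.numPendantNear_succ_of_not]
    rintro ⟨-, e | e⟩
    · exact hxv e.symm
    · exact hxp ((hadj x).1 e)

theorem CountInv.step {v : Fin n} {r m : ℕ → ℕ} (h : CountInv G L v r m) (hL : G.IsAdjList L) :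
    ∃ r' m', Reaches hubProgram 30 ⟨4, r, m⟩ ⟨4, r', m'⟩ ∧ CountInv G L (v + 1) r' m' := by
  have s1 := reaches_jumpLT r m (P := hubProgram) (pc := 4) rfl
  rw [h.reg.vertex, h.reg.size, if_pos v.2] at s1
  obtain ⟨r1, s2, e1, e7, e8⟩ := reaches_degree r m
  have hreg1 := h.reg.congr (r' := r1) fun i hi => e1 i (by omega)
  rw [h.reg.vertex, h.reg.one, h.mem.table v.2.le] at e7
  rw [h.reg.vertex, h.reg.one, h.mem.degree] at e8
  have s3 := reaches_jumpLT r1 m (P := hubProgram) (pc := 11) rfl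
  have s4 := reaches_jumpLT r1 m (P := hubProgram) (pc := 12) rfl
  rw [hreg1.one, e8] at s3 s4
  have s12 := s1.trans s2
  by_cases hgt : 1 < (L v).length
  · rw [if_pos hgt] at s3
    have hv : ¬G.IsPendant v := by
      rw [hL.isPendant_iff]
      rintro ⟨p, hp, -⟩
      simp [hp] at hgt
    obtain ⟨r', s5, h'⟩ := h.skip hv e1
    exact ⟨r', m, ((s12.trans s3).trans s5).mono (by norm_num), h'⟩
  rw [if_neg hgt] at s3
  by_cases hlt : (L v).length < 1
  · rw [if_pos hlt] at s4
    have hv : ¬G.IsPendant v := by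
      rw [hL.isPendant_iff]
      rintro ⟨p, hp, -⟩
      simp [hp] at hlt
    obtain ⟨r', s5, h'⟩ := h.skip hv e1
    exact ⟨r', m, (((s12.trans s3).trans s4).trans s5).mono (by norm_num), h'⟩
  rw [if_neg hlt] at s4
  obtain ⟨p, hp⟩ := List.length_eq_one_iff.1 (le_antisymm (not_lt.1 hgt) (not_lt.1 hlt))
  obtain ⟨r2, s5, e2, e7', e6⟩ := reaches_degree_neighbour r1 m
  have hreg2 := hreg1.congr (r' := r2) fun i hi => e2 i (by omega)
  rw [e7, h.mem.neighbour hp] at e7'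
  rw [e7, h.mem.neighbour hp, hreg1.one, h.mem.degree] at e6
  have s6 := reaches_jumpLT r2 m (P := hubProgram) (pc := 19) rfl
  rw [hreg2.one, e6] at s6
  have s15 := ((s12.trans s3).trans s4).trans s5
  by_cases hlp : 1 < (L p).length
  · rw [if_pos hlp] at s6
    have hv : G.IsPendant v := hL.isPendant_iff.2 ⟨p, hp, hlp⟩
    obtain ⟨r3, s7, e3, e5⟩ := reaches_count r2 m
    have hreg3 := hreg2.congr e3
    rw [hreg2.vertex, hreg2.base, hreg2.one, e7'] at s7
    obtain ⟨r4, s8, f3, f4, f5⟩ := reaches_next₁ r3 (Function.update (Function.update m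
      (v + tableEntry L n) 1) (p + tableEntry L n)
      (Function.update m (v + tableEntry L n) 1 (p + tableEntry L n) + 1))
    refine ⟨r4, _, (((s15.trans s6).trans s7).trans s8).mono (by norm_num),
      hreg3.next f3 (by rw [f4, hreg3.vertex, hreg3.one]), h.mem.update hL hv hp, ?_⟩
    rw [f5, e5, hreg2.one, e2 5 (by norm_num), e1 5 (by norm_num), h.count,
      SimpleGraph.numPendant_succ hv]
  · rw [if_neg hlp] at s6
    have hv : ¬G.IsPendant v := by
      rw [hL.isPendant_iff]
      rintro ⟨p', hp', hlt⟩
      rw [hp, List.singleton_inj] at hp'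
      exact hlp (hp' ▸ hlt)
    have s7 := reaches_jump r2 m (P := hubProgram) (pc := 20) rfl
    obtain ⟨r', s8, h'⟩ := h.skip hv (r := r2) fun i hi => (e2 i hi).trans (e1 i hi)
    exact ⟨r', m, (((s15.trans s6).trans s7).trans s8).mono (by norm_num), h'⟩

theorem exists_countInv (hL : G.IsAdjList L) (k : ℕ) (hk : k ≤ n) :
    ∃ r m, Reaches hubProgram (4 + 30 * k) (init (adjListInput L)) ⟨4, r, m⟩ ∧
      CountInv G L k r m := by
  induction k with
  | zero =>
    obtain ⟨r, m, hrun, h⟩ := countInv_run_four (G := G) (L := L)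
    exact ⟨r, m, ⟨4, le_rfl, hrun⟩, h⟩
  | succ k ih =>
    obtain ⟨r, m, hreach, h⟩ := ih (by omega)
    obtain ⟨r', m', hreach', h'⟩ := CountInv.step (v := ⟨k, hk⟩) h hL
    exact ⟨r', m', (hreach.trans hreach').mono (by omega), h'⟩

/-- What holds at the head of the second loop. -/
structure SearchInv (G : SimpleGraph (Fin n)) (L : Fin n → List (Fin n)) (k : ℕ)
    (r m : ℕ → ℕ) : Prop where
  reg : RegInv L k r
  mem : MemInv G L n m
  count : r 5 = n - G.numPendant n

theorem SearchInv.step {v : Fin n} {r m : ℕ → ℕ} (h : SearchInv G L v r m)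
    (hL : G.IsAdjList L) :
    (G.IsHub v ∧ ∃ r', Reaches hubProgram 20 ⟨32, r, m⟩ ⟨45, r', m⟩) ∨
      (¬G.IsHub v ∧ ∃ r', Reaches hubProgram 20 ⟨32, r, m⟩ ⟨32, r', m⟩ ∧
        SearchInv G L (v + 1) r' m) := by
  have s1 := reaches_jumpLT r m (P := hubProgram) (pc := 32) rfl
  rw [h.reg.vertex, h.reg.size, if_pos v.2] at s1
  obtain ⟨r1, s2, e1, e8⟩ := reaches_test r m
  have hreg1 := h.reg.congr (r' := r1) fun i hi => e1 i (by omega)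
  rw [h.reg.vertex, h.reg.one, h.reg.base, h.mem.degree, h.mem.near] at e8
  have e5 : r1 5 = n - G.numPendant n := (e1 5 (by norm_num)).trans h.count
  have s3 := reaches_jumpLT r1 m (P := hubProgram) (pc := 43) rfl
  have s4 := reaches_jumpLT r1 m (P := hubProgram) (pc := 44) rfl
  have hhub := hL.isHub_iff v
  rw [← e8, ← e5] at hhub
  obtain ⟨r2, s5, f3, f4, f5⟩ := reaches_next₂ r1 m
  have hnext : SearchInv G L (v + 1) r2 m :=
    ⟨hreg1.next f3 (by rw [f4, hreg1.vertex, hreg1.one]), h.mem, f5.trans e5⟩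
  rcases lt_trichotomy (r1 8) (r1 5) with hlt | heq | hgt
  · rw [if_pos hlt] at s3
    exact .inr ⟨fun hh => hlt.ne (hhub.2 hh), r2,
      (((s1.trans s2).trans s3).trans s5).mono (by norm_num), hnext⟩
  · rw [if_neg heq.not_lt] at s3
    rw [if_neg heq.not_gt] at s4
    exact .inl ⟨hhub.1 heq, r1, (((s1.trans s2).trans s3).trans s4).mono (by norm_num)⟩
  · rw [if_neg hgt.not_gt] at s3
    rw [if_pos hgt] at s4
    exact .inr ⟨fun hh => hgt.ne' (hhub.2 hh), r2,
      ((((s1.trans s2).trans s3).trans s4).trans s5).mono (by norm_num), hnext⟩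

theorem exists_searchInv (hL : G.IsAdjList L) :
    ∃ r m, Reaches hubProgram (8 + 30 * n) (init (adjListInput L)) ⟨32, r, m⟩ ∧
      SearchInv G L 0 r m := by
  obtain ⟨r, m, s0, h⟩ := exists_countInv hL n le_rfl
  have s1 := reaches_jumpLT r m (P := hubProgram) (pc := 4) rfl
  rw [h.reg.vertex, h.reg.size, if_neg (lt_irrefl n)] at s1
  have s2 := reaches_jump r m (P := hubProgram) (pc := 5) rfl
  obtain ⟨r', s3, e, e4, e5⟩ := reaches_between r m
  exact ⟨r', m, (((s0.trans s1).trans s2).trans s3).mono (by omega), h.reg.next e e4, h.mem,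
    by rw [e5, h.count, h.reg.size]⟩

/-- The second loop, started before the vertex `k`. -/
theorem SearchInv.finish (hL : G.IsAdjList L) (d : ℕ) {k : ℕ} {r m : ℕ → ℕ} (hk : k + d = n)
    (h : SearchInv G L k r m) (hno : ∀ v : Fin n, (v : ℕ) < k → ¬G.IsHub v) :
    ((∃ v, G.IsHub v) ∧ ∃ r', Reaches hubProgram (20 * d + 1) ⟨32, r, m⟩ ⟨45, r', m⟩) ∨
      ((¬∃ v, G.IsHub v) ∧ ∃ r', Reaches hubProgram (20 * d + 1) ⟨32, r, m⟩ ⟨33, r', m⟩) := by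
  induction d generalizing k r with
  | zero =>
    have s1 := reaches_jumpLT r m (P := hubProgram) (pc := 32) rfl
    rw [h.reg.vertex, h.reg.size, if_neg (by omega)] at s1
    exact .inr ⟨fun ⟨v, hv⟩ => hno v (by omega) hv, r, s1.mono (by omega)⟩
  | succ d ih =>
    have hkn : k < n := by omega
    rcases SearchInv.step (v := ⟨k, hkn⟩) h hL with ⟨hh, r', s⟩ | ⟨hh, r', s, h'⟩
    · exact .inl ⟨⟨_, hh⟩, r', s.mono (by omega)⟩
    · have hno' : ∀ v : Fin n, (v : ℕ) < k + 1 → ¬G.IsHub v := by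
        intro v hv
        rcases (SimpleGraph.val_lt_succ_iff v ⟨k, hkn⟩).1 hv with rfl | hv
        · exact hh
        · exact hno v hv
      rcases ih (show k + 1 + d = n by omega) h' hno' with ⟨hex, r2, s2⟩ | ⟨hex, r2, s2⟩
      · exact .inl ⟨hex, r2, (s.trans s2).mono (by omega)⟩
      · exact .inr ⟨hex, r2, (s.trans s2).mono (by omega)⟩

theorem Reaches.answersWithin {P : Program} {input : List ℕ} {k : ℕ} {s : Config} {b : Bool}
    (h : Reaches P k (init input) s) (hs : P[s.pc]? = some (Instr.halt b)) :
    AnswersWithin P input k b := by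
  obtain ⟨j, hj, rfl⟩ := h
  exact ⟨j, hj, hs⟩

theorem hubProgram_answers (hL : G.IsAdjList L) :
    ∃ b : Bool, AnswersWithin hubProgram (adjListInput L) (60 * (n + 1)) b ∧
      (b = true ↔ ∃ v, G.IsHub v) := by
  obtain ⟨r, m, s, h⟩ := exists_searchInv (G := G) hL
  rcases h.finish hL n (by omega) (fun v hv => absurd hv (Nat.not_lt_zero _)) with
    ⟨hex, r', s'⟩ | ⟨hex, r', s'⟩
  · exact ⟨true, ((s.trans s').mono (by omega)).answersWithin rfl, by simp [hex]⟩
  · exact ⟨false, ((s.trans s').mono (by omega)).answersWithin rfl, by simp [hex]⟩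

/-- After halting the configuration is frozen, so the linear growth bound at time `T` holds forever.
-/
theorem wordsBounded_of_answersWithin {input : List ℕ} {T M : ℕ} {b : Bool}
    (h : AnswersWithin hubProgram input T b) (hM : input.getD 0 0 + 1 ≤ M)
    (hin : ∀ i, input.getD i 0 ≤ M) : WordsBounded hubProgram input ((T + 1) * M) := by
  obtain ⟨j, hj, hhalt⟩ := h
  intro k i
  have key : ∀ k ≤ T, (run hubProgram input k).reg i ≤ (T + 1) * M ∧
      (run hubProgram input k).mem i ≤ (T + 1) * M := by
    intro k hk
    obtain ⟨h1, h2⟩ := run_le hM hin k i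
    have : (k + 1) * M ≤ (T + 1) * M := Nat.mul_le_mul_right _ (by omega)
    exact ⟨h1.trans this, h2.trans this⟩
  rcases le_total k j with hkj | hjk
  · exact key k (hkj.trans hj)
  · rw [run_eq_of_halt hhalt hjk]
    exact key j hj

end RAM

theorem SimpleGraph.IsAdjList.length_le {n : ℕ} {G : SimpleGraph (Fin n)}
    {L : Fin n → List (Fin n)} (hL : G.IsAdjList L) (v : Fin n) : (L v).length ≤ n := by
  simpa using (hL v).1.length_le_card

theorem mainTheorem10 :
    ∃ (P : RAM.Program) (c : ℕ),
      ∀ (n : ℕ) (G : SimpleGraph (Fin n)), G.IsP4Tidy →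
        ∀ L : Fin n → List (Fin n), G.IsAdjList L →
          (∃ b : Bool, RAM.AnswersWithin P (adjListInput L) (c * (n + 1)) b ∧
            (b = true ↔ G.IsAdmissible 2)) ∧
          RAM.WordsBounded P (adjListInput L) ((n + 2) ^ c) := by
  refine ⟨RAM.hubProgram, 60, fun n G hG L hL => ?_⟩
  obtain ⟨b, hb, hiff⟩ := RAM.hubProgram_answers hL
  refine ⟨⟨b, hb, hiff.trans hG.isAdmissible_two_iff.symm⟩, fun k i => ?_⟩
  have hM : (adjListInput L).getD 0 0 + 1 ≤ (n + 2) ^ 2 := by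
    rw [input_getD_zero]
    nlinarith
  -- The left side is time times the bound on input words; since `2 ≤ n + 2`, the factor `2 ^ 6` is
  -- absorbed into the power, and the exponent 60 is merely generous.
  have hle : (60 * (n + 1) + 1) * (n + 2) ^ 2 ≤ (n + 2) ^ 60 := by
    calc (60 * (n + 1) + 1) * (n + 2) ^ 2 ≤ (2 ^ 6 * (n + 2)) * (n + 2) ^ 2 :=
          Nat.mul_le_mul_right _ (by omega)
      _ ≤ ((n + 2) ^ 6 * (n + 2)) * (n + 2) ^ 2 :=
          Nat.mul_le_mul_right _ (Nat.mul_le_mul_right _ (Nat.pow_le_pow_left (by omega) 6))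
      _ = (n + 2) ^ 9 := by ring
      _ ≤ (n + 2) ^ 60 := Nat.pow_le_pow_right (by omega) (by norm_num)
  obtain ⟨h1, h2⟩ :=
    RAM.wordsBounded_of_answersWithin hb hM (input_getD_le L hL.length_le) k i
  exact ⟨h1.trans hle, h2.trans hle⟩
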